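/- Let $e, k, n$ be integers with $n \geq 2$ and $1 \leq k \leq e-1$. Let $B^{\oplus k}(e,e,n)$ be the monoid presented by generators $\tilde t_i$ ($i \in \mathbb{Z}/e\mathbb{Z}$) and $\tilde s_3, \dots, \tilde s_n$ with relations \begin{itemize} \item $\tilde s_i \tilde s_j \tilde s_i = \tilde s_j \tilde s_i \tilde s_j$ for $|i-j| = 1$, and $\tilde s_i \tilde s_j = \tilde s_j \tilde s_i$ for $|i-j| > 1$, \item $\tilde s_3 \tilde t_i \tilde s_3 = \tilde t_i \tilde s_3 \tilde t_i$ for $i \in \mathbb{Z}/e\mathbb{Z}$ (when $n \geq 3$), \item $\tilde s_j \tilde t_i = \tilde t_i \tilde s_j$ for $i \in \mathbb{Z}/e\mathbb{Z}$ and $4 \leq j \leq n$, \item $\tilde t_i \tilde t_{i-k} = \tilde t_j \tilde t_{j-k}$ for $i, j \in \mathbb{Z}/e\mathbb{Z}$, \end{itemize} and let $B^{(k)}(e,e,n)$ be its group of fractions, that is, the group with the same presentation. Let $B(2,1,n-1)$ be the Artin–Tits group of type $B_{n-1}$: the group with generators $q_1, \dots, q_{n-1}$ and relations $q_1 q_2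 q_1 q_2 = q_2 q_1 q_2 q_1$, $q_j q_{j+1} q_j = q_{j+1} q_j q_{j+1}$ for $2 \leq j \leq n-2$, and $q_i q_j = q_j q_i$ for $|i-j| > 1$. Then $B(2,1,n-1)$ embeds in $B^{(k)}(e,e,n)$. More precisely, for every $i \in \mathbb{Z}/e\mathbb{Z}$ there is an injective group homomorphism $B(2,1,n-1) \to B^{(k)}(e,e,n)$ that sends $q_1$ to $\tilde t_i \tilde t_{i-k}$ and $q_j$ to $\tilde s_{j+1}$ for $2 \leq j \leq n-1$. -/

import Mathlib

namespace GarsideB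

/-! ### Groups of fractions of presented monoids -/

/-- The defining relators `u v⁻¹`, one for each relation `u = v` of a monoid presentation. -/
def relators {α : Type*} (rels : FreeMonoid α → FreeMonoid α → Prop) : Set (FreeGroup α) :=
  {r | ∃ u v : FreeMonoid α, rels u v ∧
    r = FreeMonoid.lift FreeGroup.of u * (FreeMonoid.lift FreeGroup.of v)⁻¹}

/-- The group with the same generators and relations as the monoid `PresentedMonoid rels`.
By `nonempty_mulEquiv_of_isGroupOfFractions` below this is the group of fractions of
`PresentedMonoid rels` as soon as the latter has one. -/
abbrev FracGroup {α : Type*} (rels : FreeMonoid α → FreeMonoid α → Prop) : Type _ :=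
  PresentedGroup (relators rels)

/-- The canonical homomorphism from a presented monoid to the group with the same presentation. -/
def toFrac {α : Type*} (rels : FreeMonoid α → FreeMonoid α → Prop) :
    PresentedMonoid rels →* FracGroup rels :=
  PresentedMonoid.lift (fun x => PresentedGroup.of x) (by
    intro a b hab
    have key : ∀ w : FreeMonoid α, FreeMonoid.lift
        (fun x => (PresentedGroup.of x : FracGroup rels)) w =
        PresentedGroup.mk (relators rels) (FreeMonoid.lift FreeGroup.of w) := by
      intro w
      have : FreeMonoid.lift (fun x => (PresentedGroup.of x : FracGroup rels)) =
        (PresentedGroup.mk (relators rels)).comp (FreeMonoid.lift FreeGroup.of) := by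
        ext x
        simp [PresentedGroup.of]
      rw [this]
      rfl
    rw [key, key, ← mul_inv_eq_one, ← map_inv, ← map_mul]
    exact PresentedGroup.one_of_mem ⟨a, b, hab, rfl⟩)

/-- `ι : M → G` exhibits the group `G` as the group of (right) fractions of the monoid `M`. -/
structure IsGroupOfFractions {M G : Type*} [Monoid M] [Group G] (ι : M →* G) : Prop where
  injective : Function.Injective ι
  exists_fraction : ∀ g : G, ∃ a b : M, g = ι a * (ι b)⁻¹

/-- Any group of fractions of a presented monoid is canonically isomorphic to the group with
the same presentation. -/
theorem nonempty_mulEquiv_of_isGroupOfFractions {α : Type*}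
    (rels : FreeMonoid α → FreeMonoid α → Prop) {G : Type*} [Group G]
    (ι : PresentedMonoid rels →* G) (hι : IsGroupOfFractions ι) :
    ∃ Φ : FracGroup rels ≃* G, ∀ a, Φ (toFrac rels a) = ι a := by
  let f : α → G := fun x => ι (PresentedMonoid.of rels x)
  have hf : ∀ w : FreeMonoid α,
      FreeGroup.lift f (FreeMonoid.lift FreeGroup.of w) = ι (PresentedMonoid.mk rels w) := by
    intro w
    have : (FreeGroup.lift f).comp (FreeMonoid.lift FreeGroup.of) =
        ι.comp (PresentedMonoid.mk rels) := by
      ext x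
      simp [f, PresentedMonoid.of]
    exact DFunLike.congr_fun this w
  have hrel : ∀ r ∈ relators rels, FreeGroup.lift f r = 1 := by
    rintro r ⟨u, v, huv, rfl⟩
    rw [map_mul, map_inv, hf, hf, mul_inv_eq_one]
    exact congrArg ι ((Con.eq (conGen rels)).2 (ConGen.Rel.of u v huv))
  let Φ : FracGroup rels →* G := PresentedGroup.toGroup hrel
  have hΦ : ∀ a, Φ (toFrac rels a) = ι a := by
    intro a
    have : Φ.comp (toFrac rels) = ι := by
      ext x
      simp [Φ, f, toFrac]
    exact DFunLike.congr_fun this a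
  have ore : ∀ a b : PresentedMonoid rels, ∃ c d : PresentedMonoid rels,
      (toFrac rels b)⁻¹ * toFrac rels a = toFrac rels c * (toFrac rels d)⁻¹ := by
    intro a b
    obtain ⟨c, d, h⟩ := hι.exists_fraction ((ι b)⁻¹ * ι a)
    refine ⟨c, d, ?_⟩
    have h1 : a * d = b * c := hι.injective (by
      rw [map_mul, map_mul, mul_inv_eq_iff_eq_mul.mp h.symm]
      group)
    have h2 := congrArg (toFrac rels) h1
    rw [map_mul, map_mul] at h2
    rw [inv_mul_eq_iff_eq_mul, ← mul_assoc, ← h2, mul_inv_cancel_right]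
  let H : Subgroup (FracGroup rels) :=
    { carrier := {g | ∃ a b, g = toFrac rels a * (toFrac rels b)⁻¹}
      one_mem' := ⟨1, 1, by simp⟩
      mul_mem' := by
        rintro _ _ ⟨a, b, rfl⟩ ⟨a', b', rfl⟩
        obtain ⟨c, d, h⟩ := ore a' b
        refine ⟨a * c, b' * d, ?_⟩
        calc toFrac rels a * (toFrac rels b)⁻¹ * (toFrac rels a' * (toFrac rels b')⁻¹)
            = toFrac rels a * ((toFrac rels b)⁻¹ * toFrac rels a') * (toFrac rels b')⁻¹ := by
              group
          _ = _ := by rw [h, map_mul, map_mul]; group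
      inv_mem' := by
        rintro _ ⟨a, b, rfl⟩
        exact ⟨b, a, by simp⟩ }
  have hH : ∀ g : FracGroup rels, g ∈ H :=
    PresentedGroup.generated_by _ H
      fun x => ⟨PresentedMonoid.of rels x, 1, by rw [map_one, inv_one, mul_one]; rfl⟩
  refine ⟨MulEquiv.ofBijective Φ ⟨?_, ?_⟩, hΦ⟩
  · rw [injective_iff_map_eq_one]
    intro g hg
    obtain ⟨a, b, rfl⟩ := hH g
    rw [map_mul, map_inv, hΦ, hΦ, mul_inv_eq_one] at hg
    rw [hι.injective hg, mul_inv_cancel]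
  · intro g
    obtain ⟨a, b, rfl⟩ := hι.exists_fraction g
    exact ⟨toFrac rels a * (toFrac rels b)⁻¹, by rw [map_mul, map_inv, hΦ, hΦ]⟩

/-! ### The monoid and the group `B^{(k)}(e,e,n)` -/

/-- The generators `t̃_i` (`i ∈ ℤ/eℤ`) and `s̃_j` (`3 ≤ j ≤ n`). -/
inductive KGen (e n : ℕ) : Type
  | t (i : ZMod e) : KGen e n
  | s (j : Set.Icc 3 n) : KGen e n

/-- The defining relations of the monoid `B^{⊕k}(e,e,n)`. -/
inductive KRel (e k n : ℕ) : FreeMonoid (KGen e n) → FreeMonoid (KGen e n) → Prop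
  | s_braid (i j : Set.Icc 3 n) (h : (i : ℕ) + 1 = j) :
      KRel e k n (.of (.s i) * .of (.s j) * .of (.s i)) (.of (.s j) * .of (.s i) * .of (.s j))
  | s_comm (i j : Set.Icc 3 n) (h : (i : ℕ) + 1 < j) :
      KRel e k n (.of (.s i) * .of (.s j)) (.of (.s j) * .of (.s i))
  | st_braid (j : Set.Icc 3 n) (h : (j : ℕ) = 3) (i : ZMod e) :
      KRel e k n (.of (.s j) * .of (.t i) * .of (.s j)) (.of (.t i) * .of (.s j) * .of (.t i))
  | st_comm (j : Set.Icc 3 n) (h : 4 ≤ (j : ℕ)) (i : ZMod e) :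
      KRel e k n (.of (.s j) * .of (.t i)) (.of (.t i) * .of (.s j))
  | t_dual (i j : ZMod e) :
      KRel e k n (.of (.t i) * .of (.t (i - (k : ZMod e))))
        (.of (.t j) * .of (.t (j - (k : ZMod e))))

/-- The monoid `B^{⊕k}(e,e,n)`. -/
abbrev KMonoid (e k n : ℕ) : Type := PresentedMonoid (KRel e k n)

/-- The group `B^{(k)}(e,e,n)`, the group of fractions of `B^{⊕k}(e,e,n)`. -/
abbrev KGroup (e k n : ℕ) : Type := FracGroup (KRel e k n)

/-- The element `t̃_i` of `B^{(k)}(e,e,n)`. -/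
def KGroup.t {e k n : ℕ} (i : ZMod e) : KGroup e k n := PresentedGroup.of (KGen.t i)

/-- The element `s̃_j` of `B^{(k)}(e,e,n)`, for `3 ≤ j ≤ n`. -/
def KGroup.s {e k n : ℕ} (j : Set.Icc 3 n) : KGroup e k n := PresentedGroup.of (KGen.s j)

/-! ### The Artin–Tits group `B(2,1,m)` of type `B_m` -/

/-- The relations of the Artin–Tits monoid on `q_1, …, q_m` whose diagram is a chain with a double
edge between `q_1` and `q_2` and simple edges otherwise. -/
inductive ARel (m : ℕ) : FreeMonoid (Set.Icc 1 m) → FreeMonoid (Set.Icc 1 m) → Prop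
  | braid_four (i j : Set.Icc 1 m) (hi : (i : ℕ) = 1) (hj : (j : ℕ) = 2) :
      ARel m (.of i * .of j * .of i * .of j) (.of j * .of i * .of j * .of i)
  | braid_three (i j : Set.Icc 1 m) (hi : 2 ≤ (i : ℕ)) (hj : (i : ℕ) + 1 = j) :
      ARel m (.of i * .of j * .of i) (.of j * .of i * .of j)
  | comm (i j : Set.Icc 1 m) (h : (i : ℕ) + 1 < j) :
      ARel m (.of i * .of j) (.of j * .of i)

/-- The Artin–Tits monoid of type `B_m`. -/
abbrev ArtinMonoidB (m : ℕ) : Type := PresentedMonoid (ARel m)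

/-- The Artin–Tits group `B(2,1,m)` of type `B_m`. -/
abbrev ArtinGroupB (m : ℕ) : Type := FracGroup (ARel m)

/-- The generator `q_j` of `B(2,1,m)`, for `1 ≤ j ≤ m`. -/
def ArtinGroupB.q {m : ℕ} (j : Set.Icc 1 m) : ArtinGroupB m := PresentedGroup.of j

end GarsideB

/-!
Sending every `t̃_i` to `σ_1` and `s̃_j` to `σ_{j-1}` maps `B^{(k)}(e,e,n)` to the braid group on
`n` strands, and sends `t̃_i t̃_{i-k}` to `σ_1 ^ 2`. In the braid group, `σ_1 ^ 2, σ_2, …, σ_{n-1}`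
generate the stabilizer of the first strand, which is classically the Artin group `G` of type
`B_{n-1}`. To get injectivity without using this fact, write down the action that the braid group
would have by induction from the left regular action of `G`, namely on pairs of a strand and an
element of `G`; its braid relations follow from the relations of `G` alone. The generators of `G`,
sent through `B^{(k)}(e,e,n)` to permutations of these pairs, act on the pairs over the first
strand by left multiplication, so no nontrivial element of `G` can act trivially.
-/

namespace GarsideB

section Families

variable {G : Type*} [Group G]

/-- The elements `σ 1, …, σ m` of a group satisfy the Artin relations of type `A_m`, those of the
braid group on `m + 1` strands. The other values of `σ` are unconstrained. -/
structure IsBraidFamily (m : ℕ) (σ : ℕ → G) : Prop where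
  braid : ∀ i, 1 ≤ i → i + 1 ≤ m → σ i * σ (i + 1) * σ i = σ (i + 1) * σ i * σ (i + 1)
  comm : ∀ i j, 1 ≤ i → i + 1 < j → j ≤ m → Commute (σ i) (σ j)

/-- The elements `q 1, …, q m` of a group satisfy the Artin relations of type `B_m`. The other
values of `q` are unconstrained. -/
structure IsArtinBFamily (m : ℕ) (q : ℕ → G) : Prop where
  braid_four : 2 ≤ m → q 1 * q 2 * q 1 * q 2 = q 2 * q 1 * q 2 * q 1
  braid_three : ∀ i, 2 ≤ i → i + 1 ≤ m → q i * q (i + 1) * q i = q (i + 1) * q i * q (i + 1)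
  comm : ∀ i j, 1 ≤ i → i + 1 < j → j ≤ m → Commute (q i) (q j)

theorem conj_mul_eq_of_braid {x y : G} (h : x * y * x = y * x * y) :
    x * y * x * (x * y)⁻¹ = y := by
  rw [mul_inv_eq_iff_eq_mul, h, mul_assoc]

/-- The conjugate `q_j ⋯ q_2 q_1 q_2⁻¹ ⋯ q_j⁻¹` of `q_1`, for `1 ≤ j`. Starting the recursion with
`q 1` at `j = 0` gives the value `q 1` at `j = 1`. -/
def twist (q : ℕ → G) : ℕ → G
  | 0 => q 1
  | j + 1 => q (j + 1) * twist q j * (q (j + 1))⁻¹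

theorem twist_succ (q : ℕ → G) (j : ℕ) :
    twist q (j + 1) = q (j + 1) * twist q j * (q (j + 1))⁻¹ :=
  rfl

theorem twist_one (q : ℕ → G) : twist q 1 = q 1 :=
  mul_inv_cancel_right _ _

theorem twist_succ_mul (q : ℕ → G) (j : ℕ) :
    twist q (j + 1) * q (j + 1) = q (j + 1) * twist q j :=
  inv_mul_cancel_right _ _

namespace IsArtinBFamily

variable {m : ℕ} {q : ℕ → G}

theorem commute_twist_of_lt (hq : IsArtinBFamily m q) {i l : ℕ} (hi : 1 ≤ i) (hil : i + 1 < l)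
    (hl : l ≤ m) : Commute (twist q i) (q l) := by
  induction i, hi using Nat.le_induction with
  | base => exact twist_one q ▸ hq.comm 1 l le_rfl hil hl
  | succ i hi ih =>
    have hcomm := hq.comm (i + 1) l (by omega) hil hl
    exact (hcomm.mul_left (ih (by omega))).mul_left hcomm.inv_left

theorem commute_twist_of_gt (hq : IsArtinBFamily m q) {r l : ℕ} (hr : 2 ≤ r) (hrl : r + 1 ≤ l)
    (hl : l ≤ m) : Commute (twist q l) (q r) := by
  induction l, hrl using Nat.le_induction with
  | base =>
    obtain ⟨r, rfl⟩ := Nat.exists_eq_add_of_le' (show 1 ≤ r by omega)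
    have hconj := conj_mul_eq_of_braid (hq.braid_three (r + 1) hr hl).symm
    have htwist : twist q (r + 1 + 1) =
        q (r + 1 + 1) * q (r + 1) * twist q r * (q (r + 1 + 1) * q (r + 1))⁻¹ := by
      rw [twist_succ, twist_succ]
      group
    have hcomm : Commute (twist q r) (q (r + 1 + 1)) :=
      hq.commute_twist_of_lt (by omega) (by omega) hl
    rw [← hconj, htwist]
    exact Commute.conj_iff _ |>.2 hcomm
  | succ l hrl ih =>
    have hcomm := (hq.comm r (l + 1) (by omega) (by omega) hl).symm
    exact (hcomm.mul_left (ih (by omega))).mul_left hcomm.inv_left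

theorem twist_braid_four (hq : IsArtinBFamily m q) {i : ℕ} (hi : 1 ≤ i) (him : i + 1 ≤ m) :
    twist q i * q (i + 1) * twist q i * q (i + 1) =
      q (i + 1) * twist q i * q (i + 1) * twist q i := by
  induction i, hi using Nat.le_induction with
  | base => exact twist_one q ▸ hq.braid_four him
  | succ i hi ih =>
    -- Conjugation by `q_{i+1} q_{i+2}` carries the relation for `i` to the one for `i + 1`.
    let f := MulAut.conj (q (i + 1) * q (i + 1 + 1))
    have map_twist : f (twist q i) = twist q (i + 1) := by
      have hcomm : Commute (twist q i) (q (i + 1 + 1)) :=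
        hq.commute_twist_of_lt hi (by omega) him
      rw [MulAut.conj_apply, mul_assoc (q (i + 1)), ← hcomm.eq, twist_succ]
      group
    have map_q : f (q (i + 1)) = q (i + 1 + 1) :=
      conj_mul_eq_of_braid (hq.braid_three (i + 1) (by omega) him)
    simpa only [map_mul, map_twist, map_q] using congrArg f (ih (by omega))

theorem commute_twist_mul_twist (hq : IsArtinBFamily m q) {i : ℕ} (hi : 1 ≤ i)
    (him : i + 1 ≤ m) : Commute (twist q i * twist q (i + 1)) (q (i + 1)) :=
  calc twist q i * twist q (i + 1) * q (i + 1)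
      = twist q i * q (i + 1) * twist q i := by rw [mul_assoc, twist_succ_mul, mul_assoc]
    _ = twist q i * q (i + 1) * twist q i * q (i + 1) * (q (i + 1))⁻¹ := by group
    _ = q (i + 1) * twist q i * q (i + 1) * twist q i * (q (i + 1))⁻¹ := by
      rw [hq.twist_braid_four hi him]
    _ = q (i + 1) * (twist q i * twist q (i + 1)) := by rw [twist_succ]; group

end IsArtinBFamily

end Families

section CosetAction

variable {G : Type*} [Group G] {m : ℕ} {q : ℕ → G} {i j : ℕ} (h : G)

/-- The factor in `G` by which the `i`-th standard generator of the braid group on `m + 1` strands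
acts on the coset of index `j`. With `b_j = σ_{j-1} ⋯ σ_1` as the representative of the coset of
braids carrying strand `1` to position `j`, and `q_1 = σ_1 ^ 2`, `q_r = σ_r` for `2 ≤ r`, it is the
element `c` such that `σ_i b_j = b_{j'} c`, where `j'` is the image of `j` under the transposition
of `i` and `i + 1`. It is `1` at the nonexistent positions `j = 0` and `j > m + 1`, if `i ≤ m`. -/
def cosetCocycle (m : ℕ) (q : ℕ → G) (i j : ℕ) : G :=
  if 1 ≤ j ∧ j < i then q i
  else if j = i + 1 then twist q i
  else if i + 1 < j ∧ j ≤ m + 1 then q (i + 1)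
  else 1

/-- The action of the `i`-th standard generator of the braid group on `m + 1` strands on pairs
`(j, h)`, read as `b_j h` with `b_j` as in `cosetCocycle`: the action induced from the left regular
action of `G`, viewed as the stabilizer of the first strand. -/
def cosetPerm (m : ℕ) (q : ℕ → G) (i : ℕ) : Equiv.Perm (ℕ × G) :=
  (Equiv.swap i (i + 1)).prodShear fun j => Equiv.mulLeft (cosetCocycle m q i j)

theorem cosetPerm_apply (m : ℕ) (q : ℕ → G) (i j : ℕ) :
    cosetPerm m q i (j, h) = (Equiv.swap i (i + 1) j, cosetCocycle m q i j * h) :=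
  rfl

theorem cosetPerm_of_lt (hj : 1 ≤ j) (hji : j < i) : cosetPerm m q i (j, h) = (j, q i * h) := by
  rw [cosetPerm_apply, Equiv.swap_apply_of_ne_of_ne (by omega) (by omega), cosetCocycle,
    if_pos ⟨hj, hji⟩]

theorem cosetPerm_self : cosetPerm m q i (i, h) = (i + 1, h) := by
  simp [cosetPerm_apply, cosetCocycle]

theorem cosetPerm_succ : cosetPerm m q i (i + 1, h) = (i, twist q i * h) := by
  simp [cosetPerm_apply, cosetCocycle]

theorem cosetPerm_of_gt (hij : i + 1 < j) (hj : j ≤ m + 1) :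
    cosetPerm m q i (j, h) = (j, q (i + 1) * h) := by
  rw [cosetPerm_apply, Equiv.swap_apply_of_ne_of_ne (by omega) (by omega), cosetCocycle,
    if_neg (by omega), if_neg (by omega), if_pos ⟨hij, hj⟩]

theorem cosetPerm_of_notMem (hi : 1 ≤ i) (him : i ≤ m) (hj : j ∉ Set.Icc 1 (m + 1)) :
    cosetPerm m q i (j, h) = (j, h) := by
  rw [Set.mem_Icc] at hj
  rw [cosetPerm_apply, Equiv.swap_apply_of_ne_of_ne (by omega) (by omega), cosetCocycle,
    if_neg (by omega), if_neg (by omega), if_neg (by omega), one_mul]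

namespace IsArtinBFamily

theorem commute_cosetPerm (hq : IsArtinBFamily m q) {i l : ℕ} (hi : 1 ≤ i) (hil : i + 1 < l)
    (hl : l ≤ m) : Commute (cosetPerm m q i) (cosetPerm m q l) := by
  ext1 ⟨j, h⟩
  simp only [Equiv.Perm.mul_apply]
  have hswap {a b : G} (hab : Commute a b) : a * (b * h) = b * (a * h) := hab.left_comm h
  by_cases hj : j ∉ Set.Icc 1 (m + 1)
  · simp (disch := first | omega | exact hj) only [cosetPerm_of_notMem]
  obtain ⟨hj, hjm⟩ := Set.mem_Icc.1 (not_not.1 hj)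
  rcases lt_trichotomy j i with hji | rfl | hji
  · simp (disch := omega) only [cosetPerm_of_lt, hswap (hq.comm i l hi hil hl)]
  · simp (disch := omega) only [cosetPerm_of_lt, cosetPerm_self]
  obtain rfl | hji := eq_or_lt_of_le (show i + 1 ≤ j from hji)
  · simp (disch := omega) only [cosetPerm_of_lt, cosetPerm_succ,
      hswap (hq.commute_twist_of_lt hi hil hl)]
  rcases lt_trichotomy j l with hjl | rfl | hjl
  · simp (disch := omega) only [cosetPerm_of_lt, cosetPerm_of_gt,
      hswap (hq.comm (i + 1) l (by omega) (by omega) hl)]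
  · simp (disch := omega) only [cosetPerm_self, cosetPerm_of_gt]
  obtain rfl | hjl := eq_or_lt_of_le (show l + 1 ≤ j from hjl)
  · simp (disch := omega) only [cosetPerm_succ, cosetPerm_of_gt,
      hswap (hq.commute_twist_of_gt (r := i + 1) (by omega) (by omega) hl)]
  · simp (disch := omega) only [cosetPerm_of_gt,
      hswap (hq.comm (i + 1) (l + 1) (by omega) (by omega) (by omega))]

theorem cosetPerm_braid (hq : IsArtinBFamily m q) {i : ℕ} (hi : 1 ≤ i) (him : i + 1 ≤ m) :
    cosetPerm m q i * cosetPerm m q (i + 1) * cosetPerm m q i =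
      cosetPerm m q (i + 1) * cosetPerm m q i * cosetPerm m q (i + 1) := by
  ext1 ⟨j, h⟩
  simp only [Equiv.Perm.mul_apply]
  by_cases hj : j ∉ Set.Icc 1 (m + 1)
  · simp (disch := first | omega | exact hj) only [cosetPerm_of_notMem]
  obtain ⟨hj, hjm⟩ := Set.mem_Icc.1 (not_not.1 hj)
  rcases lt_trichotomy j i with hji | rfl | hji
  · simp (disch := omega) only [cosetPerm_of_lt, ← mul_assoc, hq.braid_three i (by omega) him]
  · simp (disch := omega) only [cosetPerm_of_lt, cosetPerm_self, cosetPerm_of_gt]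
  obtain rfl | hji := eq_or_lt_of_le (show i + 1 ≤ j from hji)
  · simp (disch := omega) only [cosetPerm_of_lt, cosetPerm_self, cosetPerm_succ,
      cosetPerm_of_gt, ← mul_assoc, twist_succ_mul]
  obtain rfl | hji := eq_or_lt_of_le (show i + 1 + 1 ≤ j from hji)
  · simp (disch := omega) only [cosetPerm_of_lt, cosetPerm_succ, cosetPerm_of_gt,
      ← mul_assoc, (hq.commute_twist_mul_twist hi him).eq]
  · simp (disch := omega) only [cosetPerm_of_gt, ← mul_assoc,
      hq.braid_three (i + 1) (by omega) (by omega)]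

theorem isBraidFamily_cosetPerm (hq : IsArtinBFamily m q) : IsBraidFamily m (cosetPerm m q) where
  braid _ hi him := hq.cosetPerm_braid hi him
  comm _ _ hi hij hj := hq.commute_cosetPerm hi hij hj

end IsArtinBFamily

end CosetAction

theorem injective_of_regular_on_generators {G X : Type*} [Group G] {S : Set G}
    (hS : Subgroup.closure S = ⊤) (ψ : G →* Equiv.Perm X) {f : G → X} (hf : Function.Injective f)
    (hψ : ∀ s ∈ S, ∀ x, ψ s (f x) = f (s * x)) : Function.Injective ψ := by
  have regular (g : G) : ∀ x, ψ g (f x) = f (g * x) := by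
    induction (show g ∈ Subgroup.closure S from hS ▸ Subgroup.mem_top g)
      using Subgroup.closure_induction with
    | mem s hs => exact hψ s hs
    | one => simp
    | mul a b _ _ ha hb => simp [ha, hb, mul_assoc]
    | inv a _ ha =>
      intro x
      rw [map_inv, Equiv.Perm.inv_eq_iff_eq, ha, mul_inv_cancel_left]
  refine (injective_iff_map_eq_one ψ).2 fun g hg => ?_
  have h := regular g 1
  rw [hg, Equiv.Perm.one_apply, mul_one] at h
  exact (hf h).symm

namespace FracGroup

variable {α G : Type*} [Group G] {rels : FreeMonoid α → FreeMonoid α → Prop}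

theorem freeGroup_lift_eq_one_of_mem_relators {f : α → G}
    (hf : ∀ u v, rels u v → FreeMonoid.lift f u = FreeMonoid.lift f v) :
    ∀ r ∈ relators rels, FreeGroup.lift f r = 1 := by
  rintro r ⟨u, v, huv, rfl⟩
  have lift_of_word (w : FreeMonoid α) :
      FreeGroup.lift f (FreeMonoid.lift FreeGroup.of w) = FreeMonoid.lift f w :=
    DFunLike.congr_fun (show (FreeGroup.lift f).comp (FreeMonoid.lift FreeGroup.of) =
      FreeMonoid.lift f by ext x; simp) w
  rw [map_mul, map_inv, mul_inv_eq_one, lift_of_word, lift_of_word, hf u v huv]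

/-- The homomorphism out of `FracGroup rels` with prescribed images of the generators, provided
that these satisfy the monoid relations `rels`. -/
def lift (f : α → G) (hf : ∀ u v, rels u v → FreeMonoid.lift f u = FreeMonoid.lift f v) :
    FracGroup rels →* G :=
  PresentedGroup.toGroup (freeGroup_lift_eq_one_of_mem_relators hf)

theorem lift_of (f : α → G)
    (hf : ∀ u v, rels u v → FreeMonoid.lift f u = FreeMonoid.lift f v) (x : α) :
    lift f hf (PresentedGroup.of x) = f x :=
  PresentedGroup.toGroup.of _

theorem freeMonoid_lift_of_eq {u v : FreeMonoid α} (huv : rels u v) :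
    FreeMonoid.lift (PresentedGroup.of (rels := relators rels)) u =
      FreeMonoid.lift (PresentedGroup.of (rels := relators rels)) v :=
  congrArg (toFrac rels) ((Con.eq (conGen rels)).2 (ConGen.Rel.of u v huv))

end FracGroup

section ArtinGroupB

variable {m : ℕ}

/-- The homomorphism from the Artin group of type `B_m` that sends `q_j` to the `j`-th member of a
family satisfying the relations of type `B_m`. -/
def IsArtinBFamily.lift {G : Type*} [Group G] {q : ℕ → G} (hq : IsArtinBFamily m q) :
    ArtinGroupB m →* G :=
  FracGroup.lift (fun j => q j) <| by
    rintro _ _ (⟨⟨_, _⟩, ⟨_, hj⟩, rfl, rfl⟩ | ⟨⟨_, _⟩, ⟨_, hj⟩, hi, rfl⟩ | ⟨i, j, hij⟩) <;>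
      simp only [map_mul, FreeMonoid.lift_eval_of]
    · exact hq.braid_four hj.2
    · exact hq.braid_three _ hi hj.2
    · exact hq.comm i j i.2.1 hij j.2.2

theorem IsArtinBFamily.lift_q {G : Type*} [Group G] {q : ℕ → G} (hq : IsArtinBFamily m q)
    (j : Set.Icc 1 m) :
    hq.lift (ArtinGroupB.q j) = q j :=
  FracGroup.lift_of _ _ _

namespace ArtinGroupB

/-- The generators `q_1, …, q_m` of the Artin group of type `B_m` as a family indexed by `ℕ`, with
the value `1` at the other indices. -/
def qFamily (m j : ℕ) : ArtinGroupB m :=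
  if h : j ∈ Set.Icc 1 m then q ⟨j, h⟩ else 1

theorem qFamily_of_mem {j : ℕ} (h : j ∈ Set.Icc 1 m) : qFamily m j = q ⟨j, h⟩ :=
  dif_pos h

theorem isArtinBFamily_qFamily (m : ℕ) : IsArtinBFamily m (qFamily m) where
  braid_four hm := by
    rw [qFamily_of_mem ⟨le_rfl, by omega⟩, qFamily_of_mem ⟨by omega, hm⟩]
    exact FracGroup.freeMonoid_lift_of_eq (ARel.braid_four _ _ rfl rfl)
  braid_three i hi him := by
    rw [qFamily_of_mem ⟨by omega, by omega⟩, qFamily_of_mem ⟨by omega, him⟩]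
    exact FracGroup.freeMonoid_lift_of_eq (ARel.braid_three _ _ hi rfl)
  comm i j hi hij hj := by
    rw [qFamily_of_mem ⟨hi, by omega⟩, qFamily_of_mem ⟨by omega, hj⟩]
    exact FracGroup.freeMonoid_lift_of_eq (ARel.comm _ _ hij)

end ArtinGroupB

end ArtinGroupB

theorem braid_four_of_braid_of_mul_eq_mul {M : Type*} [Semigroup M] {s x t u : M}
    (hx : s * x * s = x * s * x) (ht : s * t * s = t * s * t) (hu : s * u * s = u * s * u)
    (hxtu : x * t = t * u) :
    t * u * s * (t * u) * s = s * (t * u) * s * (t * u) :=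
  calc t * u * s * (t * u) * s = x * t * s * (t * u) * s := by rw [hxtu]
    _ = x * (t * s * t) * u * s := by simp only [mul_assoc]
    _ = x * s * t * (s * u * s) := by rw [← ht]; simp only [mul_assoc]
    _ = x * s * (t * u) * s * u := by rw [hu]; simp only [mul_assoc]
    _ = x * s * x * t * s * u := by rw [← hxtu]; simp only [mul_assoc]
    _ = s * x * (s * t * s) * u := by rw [← hx]; simp only [mul_assoc]
    _ = s * (x * t) * s * (t * u) := by rw [ht]; simp only [mul_assoc]
    _ = s * (t * u) * s * (t * u) := by rw [hxtu]

namespace KGroup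

variable {e k n : ℕ}

theorem s_braid (i j : Set.Icc 3 n) (h : (i : ℕ) + 1 = j) :
    (s i * s j * s i : KGroup e k n) = s j * s i * s j :=
  FracGroup.freeMonoid_lift_of_eq (KRel.s_braid i j h)

theorem commute_s_s (i j : Set.Icc 3 n) (h : (i : ℕ) + 1 < j) :
    Commute (s i : KGroup e k n) (s j) :=
  FracGroup.freeMonoid_lift_of_eq (KRel.s_comm i j h)

theorem s_t_braid (j : Set.Icc 3 n) (h : (j : ℕ) = 3) (i : ZMod e) :
    (s j * t i * s j : KGroup e k n) = t i * s j * t i :=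
  FracGroup.freeMonoid_lift_of_eq (KRel.st_braid j h i)

theorem commute_s_t (j : Set.Icc 3 n) (h : 4 ≤ (j : ℕ)) (i : ZMod e) :
    Commute (s j : KGroup e k n) (t i) :=
  FracGroup.freeMonoid_lift_of_eq (KRel.st_comm j h i)

theorem t_mul_t_sub (i j : ZMod e) :
    (t i * t (i - (k : ZMod e)) : KGroup e k n) = t j * t (j - (k : ZMod e)) :=
  FracGroup.freeMonoid_lift_of_eq (KRel.t_dual i j)

theorem braid_four (j : Set.Icc 3 n) (h : (j : ℕ) = 3) (i : ZMod e) :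
    (t i * t (i - (k : ZMod e)) * s j * (t i * t (i - (k : ZMod e))) * s j : KGroup e k n) =
      s j * (t i * t (i - (k : ZMod e))) * s j * (t i * t (i - (k : ZMod e))) :=
  have t_add_mul_t : (t (i + (k : ZMod e)) * t i : KGroup e k n) = t i * t (i - (k : ZMod e)) := by
    simpa only [add_sub_cancel_right] using t_mul_t_sub (k := k) (n := n) (i + (k : ZMod e)) i
  braid_four_of_braid_of_mul_eq_mul (s_t_braid j h (i + (k : ZMod e))) (s_t_braid j h i)
    (s_t_braid j h (i - (k : ZMod e))) t_add_mul_t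

/-- The family of type `B_{n-1}` in `B^{(k)}(e,e,n)` with members `t̃_i t̃_{i-k}` at the index `1`
and `s̃_{j+1}` at the indices `2 ≤ j ≤ n - 1`. -/
def artinBFamily (e k n : ℕ) (i : ZMod e) (j : ℕ) : KGroup e k n :=
  if h : 2 ≤ j ∧ j ≤ n - 1 then s ⟨j + 1, by grind⟩ else t i * t (i - (k : ZMod e))

theorem artinBFamily_one (i : ZMod e) : artinBFamily e k n i 1 = t i * t (i - (k : ZMod e)) :=
  dif_neg (by omega)

theorem artinBFamily_of_two_le (i : ZMod e) {j : ℕ} (hj : 2 ≤ j) (hjn : j ≤ n - 1) :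
    artinBFamily e k n i j = s ⟨j + 1, by grind⟩ :=
  dif_pos ⟨hj, hjn⟩

theorem isArtinBFamily_artinBFamily (e k n : ℕ) (i : ZMod e) :
    IsArtinBFamily (n - 1) (artinBFamily e k n i) where
  braid_four hn := by
    rw [artinBFamily_one, artinBFamily_of_two_le i le_rfl hn]
    exact braid_four _ rfl i
  braid_three j hj hjn := by
    rw [artinBFamily_of_two_le i hj (by omega), artinBFamily_of_two_le i (by omega) hjn]
    exact s_braid _ _ rfl
  comm j l hj hjl hl := by
    rw [artinBFamily_of_two_le i (j := l) (by omega) hl]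
    obtain rfl | hj := eq_or_lt_of_le hj
    · rw [artinBFamily_one]
      have commute_t (a : ZMod e) : Commute (t a : KGroup e k n) (s ⟨l + 1, by grind⟩) :=
        (commute_s_t _ (Nat.succ_le_succ hjl) a).symm
      exact (commute_t i).mul_left (commute_t (i - (k : ZMod e)))
    · rw [artinBFamily_of_two_le i hj (by omega)]
      exact commute_s_s _ _ (Nat.succ_lt_succ hjl)

section OfBraid

variable {G : Type*} [Group G] {σ : ℕ → G}

/-- The homomorphism from `B^{(k)}(e,e,n)` that sends every `t̃_i` to `σ_1` and `s̃_j` to `σ_{j-1}`,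
for elements `σ_1, …, σ_{n-1}` satisfying the braid relations. -/
def ofBraid (e k : ℕ) (hσ : IsBraidFamily (n - 1) σ) : KGroup e k n →* G :=
  FracGroup.lift
    (fun
      | .t _ => σ 1
      | .s j => σ (j - 1)) <| by
    rintro _ _ (⟨⟨i, hi⟩, ⟨_, hj⟩, rfl⟩ | ⟨⟨i, hi⟩, ⟨j, hj⟩, h⟩ | ⟨⟨_, hj⟩, rfl, _⟩ |
      ⟨⟨j, hj⟩, h, _⟩ | _) <;> simp only [map_mul, FreeMonoid.lift_eval_of]
    · obtain ⟨i, rfl⟩ := Nat.exists_eq_add_of_le' (show 1 ≤ i by grind)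
      exact hσ.braid i (by grind) (by grind)
    · exact hσ.comm _ _ (by grind) (by grind) (by grind)
    · exact (hσ.braid 1 le_rfl (by grind)).symm
    · exact (hσ.comm 1 _ le_rfl (by grind) (by grind)).symm

theorem ofBraid_t (hσ : IsBraidFamily (n - 1) σ) (i : ZMod e) : ofBraid e k hσ (t i) = σ 1 :=
  FracGroup.lift_of _ _ _

theorem ofBraid_s (hσ : IsBraidFamily (n - 1) σ) (j : Set.Icc 3 n) :
    ofBraid e k hσ (s j) = σ (j - 1) :=
  FracGroup.lift_of _ _ _

theorem ofBraid_artinBFamily_one (hσ : IsBraidFamily (n - 1) σ) (i : ZMod e) :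
    ofBraid e k hσ (artinBFamily e k n i 1) = σ 1 * σ 1 := by
  rw [artinBFamily_one, map_mul, ofBraid_t, ofBraid_t]

theorem ofBraid_artinBFamily_of_two_le (hσ : IsBraidFamily (n - 1) σ) (i : ZMod e) {j : ℕ}
    (hj : 2 ≤ j) (hjn : j ≤ n - 1) : ofBraid e k hσ (artinBFamily e k n i j) = σ j := by
  rw [artinBFamily_of_two_le i hj hjn, ofBraid_s, Nat.add_sub_cancel]

end OfBraid

theorem ofBraid_cosetPerm_artinBFamily {G : Type*} [Group G] {q : ℕ → G}
    (hq : IsArtinBFamily (n - 1) q) (i : ZMod e) {j : ℕ} (hj : 1 ≤ j) (hjn : j ≤ n - 1) (h : G) :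
    ofBraid e k hq.isBraidFamily_cosetPerm (artinBFamily e k n i j) (1, h) = (1, q j * h) := by
  obtain rfl | hj := eq_or_lt_of_le hj
  · rw [ofBraid_artinBFamily_one, Equiv.Perm.mul_apply, cosetPerm_self, cosetPerm_succ, twist_one]
  · rw [ofBraid_artinBFamily_of_two_le _ i hj hjn, cosetPerm_of_lt _ le_rfl hj]

theorem lift_artinBFamily_injective (e k n : ℕ) (i : ZMod e) :
    Function.Injective (isArtinBFamily_artinBFamily e k n i).lift := by
  have hq := ArtinGroupB.isArtinBFamily_qFamily (n - 1)
  let action := ofBraid e k hq.isBraidFamily_cosetPerm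
  suffices Function.Injective (action.comp (isArtinBFamily_artinBFamily e k n i).lift) from
    Function.Injective.of_comp (f := action) this
  refine injective_of_regular_on_generators (PresentedGroup.closure_range_of _) _
    (Prod.mk_right_injective 1) ?_
  rintro _ ⟨j, rfl⟩ h
  change action ((isArtinBFamily_artinBFamily e k n i).lift (ArtinGroupB.q j)) (1, h) =
    (1, ArtinGroupB.q j * h)
  rw [IsArtinBFamily.lift_q, ofBraid_cosetPerm_artinBFamily hq i j.2.1 j.2.2,
    ArtinGroupB.qFamily_of_mem j.2]

end KGroup

end GarsideB

theorem mainTheorem11_general (e k n : ℕ) (hn : 2 ≤ n) (i : ZMod e) :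
    ∃ φ : GarsideB.ArtinGroupB (n - 1) →* GarsideB.KGroup e k n,
      φ (GarsideB.ArtinGroupB.q ⟨1, Set.mem_Icc.2 ⟨by omega, by omega⟩⟩) =
          GarsideB.KGroup.t i * GarsideB.KGroup.t (i - (k : ZMod e)) ∧
      (∀ (j : ℕ) (hj : 2 ≤ j) (hjn : j ≤ n - 1),
        φ (GarsideB.ArtinGroupB.q ⟨j, Set.mem_Icc.2 ⟨by omega, by omega⟩⟩) =
          GarsideB.KGroup.s ⟨j + 1, Set.mem_Icc.2 ⟨by omega, by omega⟩⟩) ∧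
      Function.Injective φ := by
  have hfamily := GarsideB.KGroup.isArtinBFamily_artinBFamily e k n i
  refine ⟨hfamily.lift, ?_, fun j hj hjn => ?_,
    GarsideB.KGroup.lift_artinBFamily_injective e k n i⟩
  · rw [hfamily.lift_q, GarsideB.KGroup.artinBFamily_one]
  · rw [hfamily.lift_q, GarsideB.KGroup.artinBFamily_of_two_le i hj hjn]

theorem mainTheorem11 (e k n : ℕ) (hn : 2 ≤ n) (hk : 1 ≤ k) (hke : k < e) (i : ZMod e) :
    ∃ φ : GarsideB.ArtinGroupB (n - 1) →* GarsideB.KGroup e k n,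
      φ (GarsideB.ArtinGroupB.q ⟨1, Set.mem_Icc.2 ⟨by omega, by omega⟩⟩) =
          GarsideB.KGroup.t i * GarsideB.KGroup.t (i - (k : ZMod e)) ∧
      (∀ (j : ℕ) (hj : 2 ≤ j) (hjn : j ≤ n - 1),
        φ (GarsideB.ArtinGroupB.q ⟨j, Set.mem_Icc.2 ⟨by omega, by omega⟩⟩) =
          GarsideB.KGroup.s ⟨j + 1, Set.mem_Icc.2 ⟨by omega, by omega⟩⟩) ∧
      Function.Injective φ :=
  mainTheorem11_general e k n hn i
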